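/- Let $\Phi$ be a gain graph: a finite graph $\Gamma=(V,E)$, $n=|V|$ (multiple edges, loops, half edges with one endpoint and loose edges with none are allowed), whose links and loops carry gains in a lattice-ordered group $\mathfrak G$, reversal of an edge inverting its gain. Let $\mathfrak G$ act from the right by automorphisms on a commutative semigroup $\mathfrak W$, and let $h:V\to\mathfrak W$ be a weight function; write $(\Phi,h)$ for the weighted gain graph. A circle is (the edge set of) a connected 2-regular subgraph without half edges, so a loop is a circle of length $1$; its gain is the product of the gains of its edges as it is traversed once, and whether this is $1$ does not depend on the start or the direction. An edge set is balanced if it has no half edge and every circle in it has gain $1$. For $S\subseteq E$ let $\pi(S)$ be the set of vertex sets of the $c(S)$ components of $(V,S)$ (loose edges are not components), and $\pi_{\rm b}(S)$ the set of those $W\in\pi(S)$ for which the set $S{:}W$ of edges of $S$ with at least one endpoint in $W$ and none outside is balanced; $b(S)=|\pi_{\rm b}(S)|$. On each $W\in\pi_{\rm b}(S)$ the top switching function $\eta_S$ is the unique $\eta:W\to\mathfrak G$ such that $\eta(v)^{-1}g\,\eta(w)=1$ for every edge of $S{:}W$ with gain $g$ from $v$ to $w$, and $\bigwedge_{v\in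 W}\eta(v)=1$. Put $h/S(W)=\sum_{w\in W}h(w)\eta_S(w)$. With variables $\mathbf u=(u_k)_{k\in\mathfrak W}$, $v$, $z$, the total dichromatic polynomial is $$Q_{(\Phi,h)}(\mathbf u,v,z)=\sum_{S\subseteq E}v^{|S|-n+b(S)}z^{c(S)-b(S)}\prod_{W\in\pi_{\rm b}(S)}u_{h/S(W)} .$$ Let $M_0$ be the complete lift matroid of $\Phi$: the matroid on $E\cup\{e_0\}$ with rank function, for $S\subseteq E$, $\operatorname{rk}(S)=n-c(S)$ if $S$ is balanced, $\operatorname{rk}(S)=n-c(S)+1$ if $S$ is unbalanced, and $\operatorname{rk}(S\cup e_0)=n-c(S)+1$. The semimatroid of graph balance is the family of subsets of $E$ whose closure in $M_0$ does not contain $e_0$ (these are the balanced edge sets), with closure, circuits and independence taken from $M_0$. Its independent sets are the spanning forests of $\Phi$, i.e. the sets of links that contain no circle. Let $O$ be a linear order of $E$. An edge $e$ is externally active with respect to a spanning forest $F$ if $e\notin F$, $e$ is in the closure of $F$, and $e$ is the $O$-largest element of the unique circuit contained in $F\cup e$; $\epsilon(F)$ is the number of such edges. The forest expansion is $$F_{(\Phi,h),O}(\mathbf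 u,y)=\sum_{F}y^{\epsilon(F)}\prod_{W\in\pi(F)}u_{h/F(W)},$$ summed over all spanning forests $F$ of $\Phi$. Theorem. The forest expansion is independent of $O$. Indeed, for every linear order $O$ of $E$, $$F_{(\Phi,h),O}(\mathbf u,y)=Q_{(\Phi,h)}(\mathbf u,y-1,0).$$ -/

import Mathlib

/-- The data of an edge of a graph with vertex set `V` and gains in `G`.  `arc v w g` is an ordinary
edge (a link if `v ≠ w`, a loop if `v = w`) whose gain is `g` when it is oriented from `v` to `w`,
hence `g⁻¹` when it is oriented from `w` to `v`; the order of `v` and `w` is only a reference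
orientation.  A half edge has one endpoint, a loose edge has none; neither carries a gain. -/
inductive EdgeKind (V G : Type*) where
  | arc (v w : V) (g : G)
  | half (v : V)
  | loose

/-- A gain graph with vertex set `V`, edge set `E` and gain group `G`: multiple edges, loops, half
edges and loose edges are permitted. -/
structure GainGraph (V E G : Type*) where
  edge : E → EdgeKind V G

namespace GainGraph

section Basic

variable {V E G : Type*} [Group G] (Φ : GainGraph V E G)

def IsHalf (e : E) : Prop := ∃ v, Φ.edge e = .half v

def IsLoose (e : E) : Prop := Φ.edge e = .loose

/-- The set of endpoints of an edge. -/
def ends (e : E) : Set V :=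
  match Φ.edge e with
  | .arc v w _ => {v, w}
  | .half v => {v}
  | .loose => ∅

/-- `Φ.Step e v w g`: the edge `e` can be traversed from `v` to `w`, and its gain in that direction
is `g`. -/
inductive Step : E → V → V → G → Prop
  | fwd {e : E} {v w : V} {g : G} (h : Φ.edge e = .arc v w g) : Step e v w g
  | bwd {e : E} {v w : V} {g : G} (h : Φ.edge e = .arc v w g) : Step e w v g⁻¹

/-- Walks; every edge of a walk is traversed in a definite direction. -/
inductive Walk : V → V → Type _
  | nil (v : V) : Walk v v
  | cons {v w x : V} (e : E) (g : G) (h : Φ.Step e v w g) (p : Walk w x) : Walk v x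

namespace Walk

variable {Φ}

def edges : {v w : V} → Φ.Walk v w → List E
  | _, _, nil _ => []
  | _, _, cons e _ _ p => e :: p.edges

/-- The vertices of a walk, in order, including both ends. -/
def support : {v w : V} → Φ.Walk v w → List V
  | v, _, nil _ => [v]
  | v, _, cons _ _ _ p => v :: p.support

/-- The gain of a walk is the product of the gains of its edges in the direction of the walk. -/
def gain : {v w : V} → Φ.Walk v w → G
  | _, _, nil _ => 1
  | _, _, cons _ g _ p => g * p.gain

/-- A closed walk of positive length that repeats no edge, and no vertex except that it returns to
its start: it goes once around a circle.  Loops are circles of length 1. -/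
def IsCircle {v : V} (p : Φ.Walk v v) : Prop :=
  p.edges ≠ [] ∧ p.edges.Nodup ∧ p.support.tail.Nodup

def append : {v w x : V} → Φ.Walk v w → Φ.Walk w x → Φ.Walk v x
  | _, _, _, nil _, q => q
  | _, _, _, cons e g h p, q => cons e g h (p.append q)

theorem edges_append {v w x : V} (p : Φ.Walk v w) (q : Φ.Walk w x) :
    (p.append q).edges = p.edges ++ q.edges := by
  induction p with
  | nil => rfl
  | cons e g h p ih => simp [append, edges, ih]

theorem gain_append {v w x : V} (p : Φ.Walk v w) (q : Φ.Walk w x) :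
    (p.append q).gain = p.gain * q.gain := by
  induction p with
  | nil => simp [append, gain]
  | cons e g h p ih => simp [append, gain, ih, mul_assoc]

theorem mem_support_start {v w : V} (p : Φ.Walk v w) : v ∈ p.support := by
  cases p <;> simp [support]

theorem mem_support_end {v w : V} (p : Φ.Walk v w) : w ∈ p.support := by
  induction p with
  | nil => simp [support]
  | cons e g h p ih => simp [support, ih]

end Walk

variable {Φ}

theorem Step.symm {e : E} {v w : V} {g : G} (h : Φ.Step e v w g) : Φ.Step e w v g⁻¹ := by
  cases h with
  | fwd h => exact .bwd h
  | bwd h => simpa using Step.fwd h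

theorem Walk.exists_reverse {v w : V} (p : Φ.Walk v w) :
    ∃ q : Φ.Walk w v, (∀ e ∈ q.edges, e ∈ p.edges) ∧ q.gain = p.gain⁻¹ := by
  induction p with
  | nil v => exact ⟨.nil v, by simp [Walk.edges], by simp [Walk.gain]⟩
  | cons e g h p ih =>
    obtain ⟨q, hq, hg⟩ := ih
    refine ⟨q.append (.cons e g⁻¹ h.symm (.nil _)), ?_, ?_⟩
    · intro f hf
      simp only [Walk.edges_append, Walk.edges, List.mem_append, List.mem_cons,
        List.not_mem_nil, or_false] at hf ⊢
      exact hf.elim (fun h => .inr (hq f h)) .inl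
    · simp [Walk.gain_append, Walk.gain, hg]

variable (Φ)

/-- `v` and `w` are joined by a walk in the edge set `S`. -/
def Conn (S : Set E) (v w : V) : Prop := ∃ p : Φ.Walk v w, ∀ e ∈ p.edges, e ∈ S

/-- An edge set is balanced if it has no half edge and every circle in it has gain `1`. -/
def Balanced (S : Set E) : Prop :=
  (∀ e ∈ S, ¬ Φ.IsHalf e) ∧
    ∀ (v : V) (p : Φ.Walk v v), p.IsCircle → (∀ e ∈ p.edges, e ∈ S) → p.gain = 1

/-- A spanning forest, as an edge set: it has only loops and links and contains no circle. -/
def IsForest (F : Set E) : Prop :=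
  (∀ e ∈ F, ¬ Φ.IsHalf e ∧ ¬ Φ.IsLoose e) ∧
    ∀ (v : V) (p : Φ.Walk v v), p.IsCircle → ¬ ∀ e ∈ p.edges, e ∈ F

/-- The edges of `S` induced by `W`: they have an endpoint in `W` and none outside `W`. -/
def induce (S : Set E) (W : Set V) : Set E :=
  {e ∈ S | (Φ.ends e).Nonempty ∧ Φ.ends e ⊆ W}

/-- `η` is a switching function for `S`: switching by `η` turns the gain `g` of an edge from `v` to
`w` into `(η v)⁻¹ * g * η w`, and this is `1` for all edges in `S`. -/
def IsSwitchingFor (S : Set E) (η : V → G) : Prop :=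
  ∀ e ∈ S, ∀ v w g, Φ.edge e = .arc v w g → (η v)⁻¹ * g * η w = 1

variable {Φ}

theorem Conn.refl {S : Set E} (v : V) : Φ.Conn S v v := ⟨.nil v, by simp [Walk.edges]⟩

theorem Conn.symm {S : Set E} {v w : V} (h : Φ.Conn S v w) : Φ.Conn S w v := by
  obtain ⟨p, hp⟩ := h
  obtain ⟨q, hq, -⟩ := p.exists_reverse
  exact ⟨q, fun e he => hp e (hq e he)⟩

theorem Conn.trans {S : Set E} {v w x : V} (h : Φ.Conn S v w) (h' : Φ.Conn S w x) :
    Φ.Conn S v x := by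
  obtain ⟨p, hp⟩ := h
  obtain ⟨q, hq⟩ := h'
  refine ⟨p.append q, fun e he => ?_⟩
  rw [Walk.edges_append, List.mem_append] at he
  exact he.elim (hp e) (hq e)

theorem Conn.step {S : Set E} {e : E} {v w : V} {g : G} (he : e ∈ S) (h : Φ.Step e v w g) :
    Φ.Conn S v w := ⟨.cons e g h (.nil w), by simpa [Walk.edges] using he⟩

/-- Induction along a walk. -/
theorem Conn.rec_step {S : Set E} {r : V → V → Prop} (hr : ∀ v, r v v)
    (ht : ∀ u v w, r u v → r v w → r u w)
    (hs : ∀ e ∈ S, ∀ v w g, Φ.Step e v w g → r v w) {v w : V} (h : Φ.Conn S v w) : r v w := by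
  obtain ⟨p, hp⟩ := h
  induction p with
  | nil v => exact hr v
  | cons e g h p ih =>
    simp only [Walk.edges, List.mem_cons, forall_eq_or_imp] at hp
    exact ht _ _ _ (hs e hp.1 _ _ g h) (ih hp.2)

theorem Conn.mono {S T : Set E} (hST : S ⊆ T) {v w : V} (h : Φ.Conn S v w) : Φ.Conn T v w :=
  let ⟨p, hp⟩ := h
  ⟨p, fun e he => hST (hp e he)⟩

theorem conn_union_iff {S T : Set E} (h : ∀ e ∈ T, ∀ v w g, Φ.Step e v w g → Φ.Conn S v w)
    {v w : V} : Φ.Conn (S ∪ T) v w ↔ Φ.Conn S v w := by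
  refine ⟨fun hc => ?_, Conn.mono Set.subset_union_left⟩
  refine Conn.rec_step (r := Φ.Conn S) Conn.refl (fun _ _ _ => Conn.trans) ?_ hc
  rintro e (he | he) v w g hst
  · exact Conn.step he hst
  · exact h e he v w g hst

theorem mem_induce_of_step {S : Set E} {W : Set V} {e : E} {v w : V} {g : G} (he : e ∈ S)
    (h : Φ.Step e v w g) (hv : v ∈ W) (hw : w ∈ W) : e ∈ Φ.induce S W := by
  cases h with
  | fwd h => simp [induce, ends, h, he, hv, hw, Set.insert_subset_iff]
  | bwd h => simp [induce, ends, h, he, hv, hw, Set.insert_subset_iff]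

/-! ### Balance and switching functions -/

theorem IsSwitchingFor.step {S : Set E} {η : V → G} (hη : Φ.IsSwitchingFor S η) {e : E}
    (he : e ∈ S) {v w : V} {g : G} (h : Φ.Step e v w g) : g * η w = η v := by
  cases h with
  | fwd h =>
    have := hη e he _ _ _ h
    rw [mul_assoc, inv_mul_eq_one] at this
    exact this.symm
  | bwd h =>
    have := hη e he _ _ _ h
    rw [mul_assoc, inv_mul_eq_one] at this
    rw [this]; simp

theorem IsSwitchingFor.walk {S : Set E} {η : V → G} (hη : Φ.IsSwitchingFor S η) {v w : V}
    (p : Φ.Walk v w) (hp : ∀ e ∈ p.edges, e ∈ S) : p.gain * η w = η v := by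
  induction p with
  | nil v => simp [Walk.gain]
  | cons e g h p ih =>
    simp only [Walk.edges, List.mem_cons, forall_eq_or_imp] at hp
    rw [Walk.gain, mul_assoc, ih hp.2, hη.step hp.1 h]

theorem Walk.exists_split {v w : V} (q : Φ.Walk v w) {x : V} (hx : x ∈ q.support) :
    ∃ (a : Φ.Walk v x) (b : Φ.Walk x w), q.gain = a.gain * b.gain ∧ q.edges = a.edges ++ b.edges ∧
      a.support.Sublist q.support ∧ b.support.Sublist q.support := by
  induction q with
  | nil v =>
    simp only [Walk.support, List.mem_singleton] at hx
    subst hx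
    exact ⟨.nil _, .nil _, by simp [Walk.gain], by simp [Walk.edges], by simp, by simp⟩
  | @cons v u w e g h p ih =>
    by_cases hxv : x = v
    · subst hxv
      refine ⟨.nil _, .cons e g h p, by simp [Walk.gain], by simp [Walk.edges], ?_, by simp⟩
      simp [Walk.support]
    · simp only [Walk.support, List.mem_cons, hxv, false_or] at hx
      obtain ⟨a, b, h1, h2, h3, h4⟩ := ih hx
      refine ⟨.cons e g h a, b, by simp [Walk.gain, h1, mul_assoc], by simp [Walk.edges, h2],
        ?_, ?_⟩
      · simpa [Walk.support] using h3
      · simpa [Walk.support] using h4.trans (List.sublist_cons_self _ _)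

theorem Step.eq_or {e : E} {v w x y : V} {g k : G} (h : Φ.Step e v w g) (h' : Φ.Step e x y k) :
    (x = v ∧ y = w ∧ k = g) ∨ (x = w ∧ y = v ∧ k = g⁻¹) := by
  cases h with
  | fwd h => cases h' with
    | fwd h' => simp_all
    | bwd h' => simp_all
  | bwd h => cases h' with
    | fwd h' => simp_all
    | bwd h' => simp_all

theorem Walk.mem_support_of_step {v w : V} (q : Φ.Walk v w) {e : E} (he : e ∈ q.edges)
    {x y : V} {k : G} (h : Φ.Step e x y k) : x ∈ q.support := by
  induction q with
  | nil => simp [Walk.edges] at he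
  | cons e' g h' p ih =>
    simp only [Walk.edges, List.mem_cons] at he
    simp only [Walk.support, List.mem_cons]
    rcases he with rfl | he
    · rcases h'.eq_or h with ⟨rfl, -, -⟩ | ⟨rfl, -, -⟩
      · exact .inl rfl
      · exact .inr p.mem_support_start
    · exact .inr (ih he)

theorem Walk.edges_nodup {v w : V} (q : Φ.Walk v w) (hq : q.support.Nodup) : q.edges.Nodup := by
  induction q with
  | nil => simp [Walk.edges]
  | cons e g h p ih =>
    simp only [Walk.support, List.nodup_cons] at hq
    simp only [Walk.edges, List.nodup_cons]
    exact ⟨fun he => hq.1 (p.mem_support_of_step he h), ih hq.2⟩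

theorem Walk.eq_nil_of_nodup {v : V} (q : Φ.Walk v v) (hq : q.support.Nodup) : q = .nil v := by
  cases q with
  | nil => rfl
  | cons e g h p =>
    simp only [Walk.support, List.nodup_cons] at hq
    exact absurd p.mem_support_end hq.1

theorem Walk.gain_of_edge_mem {v w : V} (q : Φ.Walk w v) (hq : q.support.Nodup) {e : E} {g : G}
    (he : e ∈ q.edges) (h : Φ.Step e v w g) : q.gain = g⁻¹ := by
  cases q with
  | nil => simp [Walk.edges] at he
  | cons e' k h' p =>
    simp only [Walk.support, List.nodup_cons] at hq
    simp only [Walk.edges, List.mem_cons] at he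
    rcases he with rfl | he
    · rcases h.symm.eq_or h' with ⟨-, rfl, rfl⟩ | ⟨-, rfl, -⟩
      · rw [p.eq_nil_of_nodup hq.2]; simp [Walk.gain]
      · exact absurd p.mem_support_start hq.1
    · exact absurd (p.mem_support_of_step he h.symm) hq.1

theorem Balanced.exists_path {S : Set E} (hS : Φ.Balanced S) {v w : V} (p : Φ.Walk v w)
    (hp : ∀ e ∈ p.edges, e ∈ S) :
    ∃ q : Φ.Walk v w, q.support.Nodup ∧ (∀ e ∈ q.edges, e ∈ S) ∧ q.gain = p.gain := by
  induction p with
  | nil v => exact ⟨.nil v, by simp [Walk.support], hp, rfl⟩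
  | @cons v u w e g h p ih =>
    simp only [Walk.edges, List.mem_cons, forall_eq_or_imp] at hp
    obtain ⟨q, hq, hqS, hqg⟩ := ih hp.2
    by_cases hv : v ∈ q.support
    · obtain ⟨a, b, h1, h2, h3, h4⟩ := q.exists_split hv
      have haS : ∀ e ∈ a.edges, e ∈ S := fun e he => hqS e (by simp [h2, he])
      have hbS : ∀ e ∈ b.edges, e ∈ S := fun e he => hqS e (by simp [h2, he])
      have ha := hq.sublist h3
      refine ⟨b, hq.sublist h4, hbS, ?_⟩
      have key : g * a.gain = 1 := by
        by_cases hea : e ∈ a.edges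
        · rw [a.gain_of_edge_mem ha hea h]; simp
        · refine hS.2 v (.cons e g h a) ⟨by simp [Walk.edges], ?_, ?_⟩ ?_
          · simp only [Walk.edges, List.nodup_cons]
            exact ⟨hea, a.edges_nodup ha⟩
          · simpa [Walk.support] using ha
          · simp only [Walk.edges, List.mem_cons, forall_eq_or_imp]
            exact ⟨hp.1, haS⟩
      rw [Walk.gain, ← hqg, h1, ← mul_assoc, key, one_mul]
    · refine ⟨.cons e g h q, ?_, ?_, by simp [Walk.gain, hqg]⟩
      · simpa [Walk.support] using ⟨hv, hq⟩
      · simp only [Walk.edges, List.mem_cons, forall_eq_or_imp]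
        exact ⟨hp.1, hqS⟩

theorem Balanced.gain_closed {S : Set E} (hS : Φ.Balanced S) {v : V} (p : Φ.Walk v v)
    (hp : ∀ e ∈ p.edges, e ∈ S) : p.gain = 1 := by
  obtain ⟨q, hq, -, hg⟩ := hS.exists_path p hp
  rw [← hg, q.eq_nil_of_nodup hq, Walk.gain]

/-- A balanced edge set has a switching function. -/
theorem Balanced.exists_switching {S : Set E} (hS : Φ.Balanced S) :
    ∃ η : V → G, Φ.IsSwitchingFor S η := by
  let s : Setoid V := ⟨Φ.Conn S, ⟨Conn.refl, Conn.symm, Conn.trans⟩⟩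
  have hr : ∀ v, Φ.Conn S v (Quotient.mk s v).out := fun v => (Quotient.mk_out (s := s) v).symm
  choose p hp using hr
  refine ⟨fun v => (p v).gain, fun e he v w g hvw => ?_⟩
  have hst : Φ.Step e v w g := .fwd hvw
  have hout : (Quotient.mk s v) = (Quotient.mk s w) := Quotient.sound (Conn.step he hst)
  have aux : ∀ x (hx : (Quotient.mk s v).out = x) (q : Φ.Walk w x), (∀ e ∈ q.edges, e ∈ S) →
      g * q.gain = (p v).gain := by
    rintro x rfl q hq
    obtain ⟨r, hr, hrg⟩ := (p v).exists_reverse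
    have := hS.gain_closed ((Walk.cons e g hst q).append r) (by
      intro f hf
      simp only [Walk.edges_append, Walk.edges, List.mem_append, List.mem_cons] at hf
      rcases hf with (rfl | hf) | hf
      · exact he
      · exact hq f hf
      · exact hp v f (hr f hf))
    rw [Walk.gain_append, Walk.gain, hrg, mul_inv_eq_one] at this
    exact this
  rw [mul_assoc, aux _ (by rw [hout]) (p w) (hp w)]
  simp

theorem balanced_iff {S : Set E} :
    Φ.Balanced S ↔ (∀ e ∈ S, ¬ Φ.IsHalf e) ∧ ∃ η : V → G, Φ.IsSwitchingFor S η := by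
  refine ⟨fun h => ⟨h.1, h.exists_switching⟩, ?_⟩
  rintro ⟨h, η, hη⟩
  refine ⟨h, fun v p _ hp => ?_⟩
  simpa using hη.walk p hp

theorem Balanced.mono {S T : Set E} (hT : Φ.Balanced T) (h : S ⊆ T) : Φ.Balanced S :=
  ⟨fun e he => hT.1 e (h he), fun v p hp hS => hT.2 v p hp fun e he => h (hS e he)⟩

theorem balanced_empty : Φ.Balanced ∅ :=
  balanced_iff.2 ⟨by simp, fun _ => 1, by simp [IsSwitchingFor]⟩

/-- Edges that close up balanced circles with a balanced set `S` may be added to it together. -/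
theorem Balanced.union {S T : Set E} (hS : Φ.Balanced S)
    (hc : ∀ e ∈ T, ∀ v w g, Φ.Step e v w g → Φ.Conn S v w)
    (hT : ∀ e ∈ T, Φ.Balanced (insert e S)) : Φ.Balanced (S ∪ T) := by
  obtain ⟨hh, η, hη⟩ := balanced_iff.1 hS
  refine balanced_iff.2 ⟨?_, η, ?_⟩
  · rintro e (he | he)
    · exact hh e he
    · exact (hT e he).1 e (by simp)
  · rintro e (he | he) v w g hvw
    · exact hη e he v w g hvw
    · obtain ⟨-, η', hη'⟩ := balanced_iff.1 (hT e he)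
      obtain ⟨p, hp⟩ := hc e he v w g (.fwd hvw)
      have h1 := hη.walk p hp
      have h2 := hη'.walk p fun f hf => Set.mem_insert_of_mem _ (hp f hf)
      have h3 := hη'.step (Set.mem_insert e S) (.fwd hvw)
      have h4 : g = p.gain := mul_right_cancel (h3.trans h2.symm)
      rw [mul_assoc, h4, h1]; simp

/-- Adding an edge between different components of a balanced set keeps it balanced. -/
theorem Balanced.insert_bridge {S : Set E} (hS : Φ.Balanced S) {e : E} {v w : V} {g : G}
    (he : Φ.Step e v w g) (hvw : ¬ Φ.Conn S v w) : Φ.Balanced (insert e S) := by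
  classical
  obtain ⟨hh, η, hη⟩ := balanced_iff.1 hS
  have hnh : ¬ Φ.IsHalf e := by
    rintro ⟨x, hx⟩
    cases he <;> simp_all
  let η' : V → G := fun x => if Φ.Conn S w x then η x * ((η w)⁻¹ * g⁻¹ * η v) else η x
  have h1 : g * η' w = η' v := by
    have hwv : ¬ Φ.Conn S w v := fun h => hvw h.symm
    simp [η', hwv, Conn.refl, mul_assoc]
  refine balanced_iff.2 ⟨?_, η', ?_⟩
  · rintro f (rfl | hf)
    · exact hnh
    · exact hh f hf
  · rintro f (rfl | hf) x y k hxy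
    · rcases he.eq_or (.fwd hxy) with ⟨rfl, rfl, rfl⟩ | ⟨rfl, rfl, rfl⟩
      · rw [mul_assoc, h1]; simp
      · rw [← h1]; simp
    · have hst : Φ.Step f x y k := .fwd hxy
      have h2 := hη.step hf hst
      have h3 : Φ.Conn S w x ↔ Φ.Conn S w y :=
        ⟨fun h => h.trans (Conn.step hf hst), fun h => h.trans (Conn.step hf hst).symm⟩
      have h4 : k * η' y = η' x := by
        by_cases h : Φ.Conn S w y
        · simp only [η', h, h3.2 h, if_true]
          rw [← mul_assoc, h2]
        · have h' : ¬ Φ.Conn S w x := fun hx => h (h3.1 hx)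
          simp only [η', h, h', if_false]
          exact h2
      rw [mul_assoc, h4]; simp

end Basic

noncomputable section Rank

variable {V E G : Type*} [Group G] [Fintype V] (Φ : GainGraph V E G)

open Classical in
/-- The vertex set of the component of `(V, S)` that contains `v`. -/
def comp (S : Set E) (v : V) : Finset V := Finset.univ.filter fun w => Φ.Conn S v w

open Classical in
/-- The partition `π(S)` of `V` into the vertex sets of the components of `(V, S)`. -/
def parts (S : Set E) : Finset (Finset V) := Finset.univ.image (Φ.comp S)

open Classical in
/-- `π_b(S)`: the vertex sets `W` of the components of `(V, S)` for which `S:W` is balanced. -/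
def balParts (S : Set E) : Finset (Finset V) :=
  (Φ.parts S).filter fun W => Φ.Balanced (Φ.induce S (W : Set V))

/-- The number `c(S)` of components of `(V, S)`; loose edges are not counted. -/
def numComp (S : Set E) : ℕ := (Φ.parts S).card

/-- The number `b(S)` of balanced components of `(V, S)`. -/
def numBal (S : Set E) : ℕ := (Φ.balParts S).card

open Classical in
/-- The rank function of the complete lift matroid, on the ground set `E ∪ {e₀}`, which is
`Option E` with `e₀ = none`: the rank of `S ⊆ E` is `n - c(S)` if `S` is balanced and
`n - c(S) + 1` if not, and the rank of `S ∪ {e₀}` is `n - c(S) + 1`. -/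
def liftRank (X : Set (Option E)) : ℕ :=
  (Fintype.card V - Φ.numComp (some ⁻¹' X)) +
    if none ∈ X ∨ ¬ Φ.Balanced (some ⁻¹' X) then 1 else 0

variable {Φ}

theorem mem_comp {S : Set E} {v w : V} : w ∈ Φ.comp S v ↔ Φ.Conn S v w := by
  simp [comp]

theorem comp_eq_iff {S : Set E} {v w : V} : Φ.comp S v = Φ.comp S w ↔ Φ.Conn S v w := by
  constructor
  · intro h
    rw [← mem_comp, h, mem_comp]
    exact Conn.refl w
  · intro h
    ext x
    rw [mem_comp, mem_comp]
    exact ⟨fun hx => h.symm.trans hx, fun hx => h.trans hx⟩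

theorem mem_parts {S : Set E} {W : Finset V} : W ∈ Φ.parts S ↔ ∃ v, Φ.comp S v = W := by
  simp [parts]

theorem mem_comp_self (S : Set E) (v : V) : v ∈ Φ.comp S v := mem_comp.2 (Conn.refl v)

theorem parts_nonempty {S : Set E} {W : Finset V} (h : W ∈ Φ.parts S) : W.Nonempty := by
  obtain ⟨v, rfl⟩ := mem_parts.1 h
  exact ⟨v, mem_comp_self S v⟩

theorem comp_eq_of_mem_parts {S : Set E} {W : Finset V} (hW : W ∈ Φ.parts S) {v : V} (hv : v ∈ W) :
    Φ.comp S v = W := by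
  obtain ⟨w, rfl⟩ := mem_parts.1 hW
  exact (comp_eq_iff.2 (mem_comp.1 hv)).symm

theorem mem_balParts {S : Set E} {W : Finset V} :
    W ∈ Φ.balParts S ↔ W ∈ Φ.parts S ∧ Φ.Balanced (Φ.induce S (W : Set V)) := by
  simp [balParts]

theorem balParts_nonempty {S : Set E} {W : Finset V} (h : W ∈ Φ.balParts S) : W.Nonempty :=
  parts_nonempty (mem_balParts.1 h).1

theorem numComp_le (S : Set E) : Φ.numComp S ≤ Fintype.card V := by
  classical
  exact Finset.card_image_le

theorem parts_union {S T : Set E} (h : ∀ e ∈ T, ∀ v w g, Φ.Step e v w g → Φ.Conn S v w) :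
    Φ.parts (S ∪ T) = Φ.parts S := by
  have : Φ.comp (S ∪ T) = Φ.comp S := by
    ext v w
    rw [mem_comp, mem_comp, conn_union_iff h]
  rw [parts, parts, this]

theorem numComp_insert_of_conn {S : Set E} {e : E}
    (h : ∀ v w g, Φ.Step e v w g → Φ.Conn S v w) : Φ.numComp (insert e S) = Φ.numComp S := by
  rw [Set.insert_eq, Set.union_comm, numComp, numComp, parts_union]
  rintro f rfl
  exact h

theorem numComp_insert_of_not_conn {S : Set E} {e : E} {v w : V} {g : G} (he : Φ.Step e v w g)
    (hvw : ¬ Φ.Conn S v w) : Φ.numComp S = Φ.numComp (insert e S) + 1 := by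
  classical
  set A := Φ.comp S v with hA
  set B := Φ.comp S w with hB
  have hAB : A ≠ B := fun h => hvw (comp_eq_iff.1 h)
  have hconn : ∀ x y, Φ.Conn (insert e S) x y ↔
      Φ.Conn S x y ∨ (x ∈ A ∪ B ∧ y ∈ A ∪ B) := by
    have hmono : ∀ {x y}, Φ.Conn S x y → Φ.Conn (insert e S) x y :=
      fun h => Conn.mono (Set.subset_insert e S) h
    have hcl : ∀ {x y}, Φ.Conn S x y → (x ∈ A ∪ B ↔ y ∈ A ∪ B) := by
      intro x y h
      simp only [Finset.mem_union, hA, hB, mem_comp]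
      exact ⟨fun k => k.imp (fun k => k.trans h) (fun k => k.trans h),
        fun k => k.imp (fun k => k.trans h.symm) (fun k => k.trans h.symm)⟩
    intro x y
    constructor
    · refine Conn.rec_step (r := fun x y => Φ.Conn S x y ∨ (x ∈ A ∪ B ∧ y ∈ A ∪ B))
        (fun v => .inl (Conn.refl v)) ?_ ?_
      · rintro a b c (h | h) (k | k)
        · exact .inl (h.trans k)
        · exact .inr ⟨(hcl h).2 k.1, k.2⟩
        · exact .inr ⟨h.1, (hcl k).1 h.2⟩
        · exact .inr ⟨h.1, k.2⟩
      · rintro f (rfl | hf) a b k hst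
        · have hv : v ∈ A ∪ B := Finset.mem_union_left _ (mem_comp_self S v)
          have hw : w ∈ A ∪ B := Finset.mem_union_right _ (mem_comp_self S w)
          rcases he.eq_or hst with ⟨rfl, rfl, -⟩ | ⟨rfl, rfl, -⟩
          · exact .inr ⟨hv, hw⟩
          · exact .inr ⟨hw, hv⟩
        · exact .inl (Conn.step hf hst)
    · rintro (h | ⟨h, k⟩)
      · exact hmono h
      · have hv : ∀ z ∈ A ∪ B, Φ.Conn (insert e S) v z := by
          intro z hz
          simp only [Finset.mem_union, hA, hB, mem_comp] at hz
          rcases hz with hz | hz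
          · exact hmono hz
          · exact (Conn.step (Set.mem_insert e S) he).trans (hmono hz)
        exact (hv x h).symm.trans (hv y k)
  have hparts : Φ.parts (insert e S) = insert (A ∪ B) (((Φ.parts S).erase A).erase B) := by
    ext W
    simp only [Finset.mem_insert, Finset.mem_erase, mem_parts]
    constructor
    · rintro ⟨x, rfl⟩
      by_cases hx : x ∈ A ∪ B
      · left
        ext y
        rw [mem_comp, hconn]
        refine ⟨?_, fun hy => .inr ⟨hx, hy⟩⟩
        rintro (h | h)
        · simp only [Finset.mem_union, hA, hB, mem_comp] at hx ⊢
          exact hx.imp (fun k => k.trans h) (fun k => k.trans h)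
        · exact h.2
      · right
        have hcx : Φ.comp (insert e S) x = Φ.comp S x := by
          ext y
          rw [mem_comp, mem_comp, hconn]
          simp [hx]
        rw [hcx]
        refine ⟨fun h => hx ?_, fun h => hx ?_, x, rfl⟩
        · exact Finset.mem_union_right _ (h ▸ mem_comp_self S x)
        · exact Finset.mem_union_left _ (h ▸ mem_comp_self S x)
    · rintro (rfl | ⟨hWB, hWA, x, rfl⟩)
      · refine ⟨v, ?_⟩
        ext y
        rw [mem_comp, hconn]
        constructor
        · rintro (h | h)
          · exact Finset.mem_union_left _ (mem_comp.2 h)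
          · exact h.2
        · exact fun h => .inr ⟨Finset.mem_union_left _ (mem_comp_self S v), h⟩
      · refine ⟨x, ?_⟩
        have hx : x ∉ A ∪ B := by
          simp only [Finset.mem_union, hA, hB, mem_comp, not_or]
          exact ⟨fun h => hWA (comp_eq_iff.2 h.symm), fun h => hWB (comp_eq_iff.2 h.symm)⟩
        ext y
        rw [mem_comp, mem_comp, hconn]
        simp [hx]
  have hAm : A ∈ Φ.parts S := mem_parts.2 ⟨v, rfl⟩
  have hBm : B ∈ (Φ.parts S).erase A := Finset.mem_erase.2 ⟨hAB.symm, mem_parts.2 ⟨w, rfl⟩⟩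
  have hnot : A ∪ B ∉ ((Φ.parts S).erase A).erase B := by
    intro h
    obtain ⟨-, hne, hm⟩ := by simpa only [Finset.mem_erase] using h
    obtain ⟨x, hx⟩ := mem_parts.1 hm
    apply hne
    have hvx : v ∈ Φ.comp S x := hx ▸ Finset.mem_union_left _ (mem_comp_self S v)
    rw [← hx, hA, comp_eq_iff]
    exact mem_comp.1 hvx
  rw [numComp, numComp, hparts, Finset.card_insert_of_notMem hnot, ← Finset.card_erase_add_one hAm,
    ← Finset.card_erase_add_one hBm]

/-- Adding a point raises the rank by 0 or 1. -/
theorem liftRank_insert (X : Set (Option E)) (x : Option E) :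
    Φ.liftRank X ≤ Φ.liftRank (insert x X) ∧ Φ.liftRank (insert x X) ≤ Φ.liftRank X + 1 := by
  cases x with
  | none =>
    have : some ⁻¹' (insert none X) = some ⁻¹' X := by ext; simp
    rw [liftRank, liftRank, this]
    simp only [Set.mem_insert_iff, true_or, if_true]
    split_ifs <;> omega
  | some e =>
    have h1 : some ⁻¹' (insert (some e) X) = insert e (some ⁻¹' X) := by ext; simp
    have h2 : none ∈ insert (some e) X ↔ none ∈ X := by simp
    rw [liftRank, liftRank, h1, h2]
    by_cases h : ∀ v w g, Φ.Step e v w g → Φ.Conn (some ⁻¹' X) v w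
    · rw [numComp_insert_of_conn h]
      have h3 : none ∈ X ∨ ¬ Φ.Balanced (some ⁻¹' X) →
          none ∈ X ∨ ¬ Φ.Balanced (insert e (some ⁻¹' X)) :=
        Or.imp_right fun h hb => h (hb.mono (Set.subset_insert _ _))
      split_ifs <;> first | omega | tauto
    · push Not at h
      obtain ⟨v, w, g, hst, hvw⟩ := h
      have h3 : Φ.Balanced (insert e (some ⁻¹' X)) ↔ Φ.Balanced (some ⁻¹' X) :=
        ⟨fun hb => hb.mono (Set.subset_insert _ _), fun hb => hb.insert_bridge hst hvw⟩
      have h4 := numComp_insert_of_not_conn hst hvw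
      have h5 := Φ.numComp_le (some ⁻¹' X)
      rw [h3]
      omega

/-- If no single point of `Y` raises the rank of `X`, then `Y` does not. -/
theorem liftRank_union {X Y : Set (Option E)}
    (h : ∀ x ∈ Y, Φ.liftRank (insert x X) = Φ.liftRank X) :
    Φ.liftRank (X ∪ Y) = Φ.liftRank X := by
  have hins : ∀ e : E, some ⁻¹' (insert (some e) X) = insert e (some ⁻¹' X) := by
    intro e; ext; simp
  have hcon : ∀ e ∈ some ⁻¹' Y, ∀ v w g, Φ.Step e v w g → Φ.Conn (some ⁻¹' X) v w := by
    intro e he v w g hst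
    by_contra hvw
    have h1 := h _ he
    rw [liftRank, liftRank, hins] at h1
    have h3 : Φ.Balanced (insert e (some ⁻¹' X)) ↔ Φ.Balanced (some ⁻¹' X) :=
      ⟨fun hb => hb.mono (Set.subset_insert _ _), fun hb => hb.insert_bridge hst hvw⟩
    have h2 : none ∈ insert (some e) X ↔ none ∈ X := by simp
    have h4 := numComp_insert_of_not_conn hst hvw
    have h5 := Φ.numComp_le (some ⁻¹' X)
    rw [h3, h2] at h1
    omega
  have hnum : Φ.numComp (some ⁻¹' (X ∪ Y)) = Φ.numComp (some ⁻¹' X) := by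
    rw [Set.preimage_union, numComp, numComp, parts_union hcon]
  have hind : (none ∈ X ∪ Y ∨ ¬ Φ.Balanced (some ⁻¹' (X ∪ Y))) ↔
      (none ∈ X ∨ ¬ Φ.Balanced (some ⁻¹' X)) := by
    constructor
    · intro h1
      by_contra h2
      push Not at h2
      obtain ⟨hn, hb⟩ := h2
      have hnY : none ∉ Y := by
        intro hY
        have h3 := h _ hY
        have : some ⁻¹' (insert none X) = some ⁻¹' X := by ext; simp
        rw [liftRank, liftRank, this] at h3
        simp [hn, hb] at h3
      have hbY : ∀ e ∈ some ⁻¹' Y, Φ.Balanced (insert e (some ⁻¹' X)) := by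
        intro e he
        by_contra hbe
        have h3 := h _ he
        rw [liftRank, liftRank, hins, numComp_insert_of_conn (hcon e he)] at h3
        simp [hn, hb, hbe] at h3
      rcases h1 with h1 | h1
      · exact h1.elim hn hnY
      · exact h1 (by rw [Set.preimage_union]; exact hb.union hcon hbY)
    · rintro (h1 | h1)
      · exact .inl (.inl h1)
      · refine .inr fun hb => h1 (hb.mono ?_)
        rw [Set.preimage_union]
        exact Set.subset_union_left
  unfold liftRank
  rw [hnum]
  congr 1
  split_ifs <;> tauto

theorem liftRank_empty : Φ.liftRank ∅ = 0 := by
  have hn : Φ.numComp ∅ = Fintype.card V := by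
    classical
    rw [numComp, parts, Finset.card_image_of_injective, Finset.card_univ]
    intro v w h
    rw [comp_eq_iff] at h
    exact Conn.rec_step (r := Eq) (fun _ => rfl) (fun _ _ _ => Eq.trans) (by simp) h
  simp [liftRank, hn, balanced_empty]

theorem liftRank_union_le [Finite E] (X Y : Set (Option E)) :
    Φ.liftRank X ≤ Φ.liftRank (X ∪ Y) ∧ Φ.liftRank (X ∪ Y) ≤ Φ.liftRank X + Y.ncard := by
  induction Y, Set.toFinite Y using Set.Finite.induction_on with
  | empty => simp
  | @insert a Y ha hY ih =>
    rw [Set.union_insert, Set.ncard_insert_of_notMem ha hY]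
    have := Φ.liftRank_insert (X ∪ Y) a
    omega

theorem liftRank_mono [Finite E] {X Y : Set (Option E)} (h : X ⊆ Y) :
    Φ.liftRank X ≤ Φ.liftRank Y := by
  have := (Φ.liftRank_union_le X Y).1
  rwa [Set.union_eq_self_of_subset_left h] at this

theorem liftRank_le_ncard [Finite E] (X : Set (Option E)) : Φ.liftRank X ≤ X.ncard := by
  have := (Φ.liftRank_union_le ∅ X).2
  rwa [Set.empty_union, liftRank_empty, zero_add] at this

variable (Φ)

/-- The complete lift matroid: the matroid on `E ∪ {e₀}` with rank function `liftRank`. -/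
def liftMatroid [Finite E] : Matroid (Option E) :=
  (IndepMatroid.ofFinite (E := Set.univ) Set.finite_univ
    (fun X => Φ.liftRank X = X.ncard)
    (by simpa using Φ.liftRank_empty)
    (by
      intro I J hJ hIJ
      have h1 := (Φ.liftRank_union_le I (J \ I)).2
      rw [Set.union_sdiff_cancel hIJ, hJ] at h1
      have h2 := Set.ncard_sdiff_add_ncard_of_subset hIJ
      have h3 := Φ.liftRank_le_ncard I
      omega)
    (by
      intro I J hI hJ hlt
      by_contra hcon
      push Not at hcon
      have h1 : Φ.liftRank (I ∪ J) = Φ.liftRank I := by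
        refine liftRank_union fun x hx => ?_
        by_cases hxI : x ∈ I
        · rw [Set.insert_eq_of_mem hxI]
        · have h2 := hcon x hx hxI
          rw [Set.ncard_insert_of_notMem hxI] at h2
          have h3 := Φ.liftRank_insert I x
          omega
      have h4 := Φ.liftRank_mono (Set.subset_union_right (s := I) (t := J))
      omega)
    (fun _ _ => Set.subset_univ _)).matroid

variable {Φ}

theorem liftMatroid_indep_iff [Finite E] {X : Set (Option E)} :
    Φ.liftMatroid.Indep X ↔ Φ.liftRank X = X.ncard := by
  simp [liftMatroid]

theorem liftMatroid_ground [Finite E] : Φ.liftMatroid.E = Set.univ := rfl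

/-- `liftRank` is indeed the rank function of `liftMatroid`. -/
theorem liftMatroid_eRk [Finite E] (X : Set (Option E)) :
    Φ.liftMatroid.eRk X = Φ.liftRank X := by
  obtain ⟨B, hB⟩ := Φ.liftMatroid.exists_isBasis X (by simp [liftMatroid_ground])
  have hi := liftMatroid_indep_iff.1 hB.indep
  have h1 : Φ.liftRank (B ∪ X) = Φ.liftRank B := by
    refine liftRank_union fun x hx => ?_
    by_cases hxB : x ∈ B
    · rw [Set.insert_eq_of_mem hxB]
    · have h2 : ¬ Φ.liftMatroid.Indep (insert x B) := fun h =>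
        hxB (hB.mem_of_insert_indep hx h)
      rw [liftMatroid_indep_iff, Set.ncard_insert_of_notMem hxB] at h2
      have h3 := Φ.liftRank_insert B x
      omega
  rw [Set.union_eq_self_of_subset_left hB.subset] at h1
  rw [hB.eRk_eq_encard, h1, hi, (Set.toFinite B).cast_ncard_eq]

/-- The basepoint is not a loop of the complete lift matroid. -/
theorem liftMatroid_isNonloop_none [Finite E] : Φ.liftMatroid.IsNonloop none := by
  rw [← Matroid.indep_singleton, liftMatroid_indep_iff, Set.ncard_singleton]
  have h1 := Φ.liftRank_le_ncard {none}
  have h2 : 1 ≤ Φ.liftRank {none} := by simp [liftRank]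
  rw [Set.ncard_singleton] at h1
  omega

end Rank

end GainGraph

/-! ### Activity in a semimatroid

The semimatroid associated with a matroid `M₀` on `E ∪ {e₀}`, here `Option E` with `e₀ = none`,
consists of the balanced sets, i.e. the subsets of `E` whose closure does not contain `e₀`, with the
closures, circuits, independent sets of `M₀` restricted to them. -/

namespace Semimatroid

variable {E : Type*} (M₀ : Matroid (Option E))

/-- Balanced sets of the semimatroid. -/
def SemiBalanced (S : Set E) : Prop := none ∉ M₀.closure (some '' S)

/-- Independent sets of the semimatroid: the balanced independent sets of `M₀`. -/
def SemiIndep (F : Set E) : Prop := M₀.Indep (some '' F) ∧ SemiBalanced M₀ F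

/-- `e` is externally active with respect to the independent set `F`: it lies in the closure of `F`
but not in `F`, and it is the largest point of its fundamental circuit. -/
def ExternallyActive (O : LinearOrder E) (F : Set E) (e : E) : Prop :=
  SemiIndep M₀ F ∧ e ∉ F ∧ some e ∈ M₀.closure (some '' F) ∧
    ∀ f : E, some f ∈ M₀.fundCircuit (some e) (some '' F) → O.le f e

/-- The number `ε(F)` of externally active points. -/
noncomputable def numExtActive (O : LinearOrder E) (F : Set E) : ℕ :=
  {e | ExternallyActive M₀ O F e}.ncard

end Semimatroid

/-! ### Sums in a commutative semigroup -/

section NonemptySum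

variable {V K : Type*} [AddCommSemigroup K]

theorem Finset.coe_sum_ne_zero {s : Finset V} (hs : s.Nonempty) (f : V → K) :
    ∑ v ∈ s, (f v : WithZero K) ≠ 0 := by
  have : ∃ k : K, ∑ v ∈ s, (f v : WithZero K) = k := by
    induction hs using Finset.Nonempty.cons_induction with
    | singleton a => exact ⟨f a, by simp⟩
    | cons a s ha hs ih =>
      obtain ⟨k, hk⟩ := ih
      exact ⟨f a + k, by rw [Finset.sum_cons, hk, WithZero.coe_add]⟩
  obtain ⟨k, hk⟩ := this
  rw [hk]
  exact WithZero.coe_ne_zero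

/-- The sum of a nonempty finite family in a commutative semigroup (which need not have a zero). -/
def Finset.nonemptySum (s : Finset V) (hs : s.Nonempty) (f : V → K) : K :=
  WithZero.unzero (Finset.coe_sum_ne_zero hs f)

theorem Finset.coe_nonemptySum (s : Finset V) (hs : s.Nonempty) (f : V → K) :
    ((s.nonemptySum hs f : K) : WithZero K) = ∑ v ∈ s, (f v : WithZero K) :=
  WithZero.coe_unzero _

end NonemptySum

namespace GainGraph

noncomputable section Weights

variable {V E G : Type*} [Group G] [Lattice G] [Fintype V] (Φ : GainGraph V E G)

/-- `η` is, on the vertex sets `W` of the balanced components of `S`, the top switching function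
for `S`: it is a switching function for `S:W`, and the meet of its values on `W` is `1`. -/
def IsTopSwitching (S : Set E) (η : V → G) : Prop :=
  ∀ (W : Finset V) (hW : W ∈ Φ.balParts S),
    Φ.IsSwitchingFor (Φ.induce S (W : Set V)) η ∧ W.inf' (balParts_nonempty hW) η = 1

/-- Top switching functions exist. -/
theorem exists_isTopSwitching [MulLeftMono G] [MulRightMono G] (S : Set E) :
    ∃ η : V → G, Φ.IsTopSwitching S η := by
  classical
  have h : ∀ W : Finset V, ∃ η : V → G, Φ.Balanced (Φ.induce S (W : Set V)) →
      Φ.IsSwitchingFor (Φ.induce S (W : Set V)) η := by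
    intro W
    by_cases hb : Φ.Balanced (Φ.induce S (W : Set V))
    · obtain ⟨η, hη⟩ := hb.exists_switching
      exact ⟨η, fun _ => hη⟩
    · exact ⟨1, fun h => absurd h hb⟩
  choose η₀ hη₀ using h
  let η : V → G := fun v =>
    η₀ (Φ.comp S v) v * ((Φ.comp S v).inf' ⟨v, mem_comp_self S v⟩ (η₀ (Φ.comp S v)))⁻¹
  refine ⟨η, fun W hW => ?_⟩
  have hne := balParts_nonempty hW
  have hη : ∀ v ∈ W, η v = η₀ W v * (W.inf' hne (η₀ W))⁻¹ := by
    intro v hv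
    have hc := comp_eq_of_mem_parts (mem_balParts.1 hW).1 hv
    simp only [η]
    subst hc
    rfl
  constructor
  · intro e he v w g hvw
    have h1 := hη₀ W (mem_balParts.1 hW).2 e he v w g hvw
    have h2 : v ∈ W ∧ w ∈ W := by
      have h3 := he.2.2
      simpa [ends, hvw, Set.insert_subset_iff] using h3
    rw [hη v h2.1, hη w h2.2, mul_inv_rev, inv_inv]
    set c := W.inf' hne (η₀ W)
    calc c * (η₀ W v)⁻¹ * g * (η₀ W w * c⁻¹) = c * ((η₀ W v)⁻¹ * g * η₀ W w) * c⁻¹ := by group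
      _ = 1 := by rw [h1]; group
  · rw [Finset.inf'_congr hne rfl hη]
    have h4 := map_finset_inf' (OrderIso.mulRight (W.inf' hne (η₀ W))⁻¹) hne (η₀ W)
    have h5 : W.inf' hne (fun v => η₀ W v * (W.inf' hne (η₀ W))⁻¹) =
        W.inf' hne (η₀ W) * (W.inf' hne (η₀ W))⁻¹ := h4.symm
    rw [h5, mul_inv_cancel]

variable {Φ} in
/-- On the balanced components the top switching function is unique. -/
theorem IsTopSwitching.unique [MulLeftMono G] [MulRightMono G] {S : Set E} {η η' : V → G}
    (h : Φ.IsTopSwitching S η) (h' : Φ.IsTopSwitching S η') {W : Finset V}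
    (hW : W ∈ Φ.balParts S) {v : V} (hv : v ∈ W) : η v = η' v := by
  have hne := balParts_nonempty hW
  have key : ∀ w ∈ W, η' w = η w * ((η v)⁻¹ * η' v) := by
    intro w hw
    have hc := comp_eq_of_mem_parts (mem_balParts.1 hW).1 hv
    have hvw : Φ.Conn S v w := by rw [← mem_comp, hc]; exact hw
    have hr := Conn.rec_step (r := fun a b => a ∈ W → b ∈ W ∧ (η a)⁻¹ * η' a = (η b)⁻¹ * η' b)
      (fun a ha => ⟨ha, rfl⟩)
      (fun a b c hab hbc ha => ⟨(hbc (hab ha).1).1, (hab ha).2.trans (hbc (hab ha).1).2⟩)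
      (fun e he a b g hst ha => by
        have hcb : b ∈ W := by
          rw [← comp_eq_of_mem_parts (mem_balParts.1 hW).1 ha, mem_comp]
          exact Conn.step he hst
        refine ⟨hcb, ?_⟩
        have hi := mem_induce_of_step (W := (W : Set V)) he hst ha hcb
        rw [← (h W hW).1.step hi hst, ← (h' W hW).1.step hi hst]
        group) hvw
    rw [(hr hv).2]; group
  have h1 := (h' W hW).2
  rw [Finset.inf'_congr hne rfl key] at h1
  have h2 := map_finset_inf' (OrderIso.mulRight ((η v)⁻¹ * η' v)) hne η
  have h3 : W.inf' hne (fun w => η w * ((η v)⁻¹ * η' v)) = W.inf' hne η * ((η v)⁻¹ * η' v) :=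
    h2.symm
  rw [h3, (h W hW).2, one_mul, inv_mul_eq_one] at h1
  exact h1

variable [MulLeftMono G] [MulRightMono G]

/-- The top switching function `η_S`. -/
def topSwitching (S : Set E) : V → G := (Φ.exists_isTopSwitching S).choose

theorem topSwitching_spec (S : Set E) : Φ.IsTopSwitching S (Φ.topSwitching S) :=
  (Φ.exists_isTopSwitching S).choose_spec

variable {K : Type*} [AddCommSemigroup K] [MulAction Gᵐᵒᵖ K] (h : V → K)

/-- The contracted weight `h/S(W) = ∑_{w ∈ W} h(w) η_S(w)`; `G` acts on the weights from the
right. -/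
def contractWeight (S : Set E) (W : Finset V) (hW : W.Nonempty) : K :=
  W.nonemptySum hW fun w => MulOpposite.op (Φ.topSwitching S w) • h w

variable [Fintype E] {R : Type*} [CommRing R]

/-- The total dichromatic polynomial
`Q(u, v, z) = ∑_{S ⊆ E} v^(|S| - n + b(S)) z^(c(S) - b(S)) ∏_{W ∈ π_b(S)} u_{h/S(W)}`,
with the values of its variables in an arbitrary commutative ring.  The exponents are nonnegative
integers, so the subtractions do not truncate. -/
def totalDichromatic (u : K → R) (v z : R) : R :=
  ∑ S : Finset E, v ^ (S.card + Φ.numBal (S : Set E) - Fintype.card V) *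
    z ^ (Φ.numComp (S : Set E) - Φ.numBal (S : Set E)) *
    ∏ W : {W // W ∈ Φ.balParts (S : Set E)},
      u (Φ.contractWeight h (S : Set E) W.1 (balParts_nonempty W.2))

open Classical in
/-- The forest expansion `F_O(u, y) = ∑_F y^ε(F) ∏_{W ∈ π(F)} u_{h/F(W)}` over the spanning forests
`F`, with activities in the semimatroid of graph balance, i.e. the one associated with the complete
lift matroid and its basepoint. -/
def forestExpansion (O : LinearOrder E) (u : K → R) (y : R) : R :=
  ∑ F : Finset E with Φ.IsForest (F : Set E),
    y ^ Semimatroid.numExtActive Φ.liftMatroid O (F : Set E) *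
    ∏ W : {W // W ∈ Φ.parts (F : Set E)},
      u (Φ.contractWeight h (F : Set E) W.1 (parts_nonempty W.2))

end Weights

end GainGraph

/-!
At `z = 0` only the balanced edge sets contribute to the total dichromatic polynomial.  Run the
greedy algorithm through a balanced set `S` in the order `O`, keeping each edge that is not spanned
by smaller ones; the result is a spanning forest `F` with the same closure.  The balanced sets with
a given `F` form the interval from `F` to the union of `F` and its externally active edges, and on
this interval the components and the contracted weights do not change.  The sum of
`(y - 1) ^ (|S| - |F|)` over the interval is `y ^ ε(F)` by the binomial theorem.
-/

section GreedyBasis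

variable {α : Type*} {M : Matroid α}

theorem mem_closure_iff_fundCircuit_subset {I J : Set α} {e : α} (hI : M.Indep I)
    (he : e ∈ M.closure I) (heI : e ∉ I) (hJ : J ⊆ I) :
    e ∈ M.closure J ↔ M.fundCircuit e I ⊆ insert e J := by
  constructor
  · intro heJ
    rw [Matroid.fundCircuit_eq_sInter he]
    exact Set.insert_subset_insert (Set.sInter_subset_of_mem ⟨hJ, heJ⟩)
  · intro hsub
    have hmem := (hI.fundCircuit_isCircuit he heI).mem_closure_sdiff_singleton_of_mem
      (M.mem_fundCircuit e I)
    exact M.closure_subset_closure (Set.sdiff_singleton_subset_iff.2 hsub) hmem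

variable [LinearOrder α] {S T F : Set α} {e : α}

/-- The basis of `S` chosen by the greedy algorithm, which runs through `S` in increasing order and
keeps each element not spanned by the smaller ones. -/
def greedyBasis (M : Matroid α) (S : Set α) : Set α :=
  {e ∈ S | e ∉ M.closure (S ∩ Set.Iio e)}

/-- The elements outside `F` that are spanned by the smaller elements of `F`.  For an independent
set `F` these are the externally active elements; this form of the definition avoids circuits. -/
def externallyActiveSet (M : Matroid α) (F : Set α) : Set α :=
  {e | e ∉ F ∧ e ∈ M.closure (F ∩ Set.Iio e)}

theorem greedyBasis_subset : greedyBasis M S ⊆ S := fun _ h => h.1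

theorem externallyActiveSet_subset_closure : externallyActiveSet M F ⊆ M.closure F := fun _ h =>
  M.closure_subset_closure Set.inter_subset_left h.2

theorem closure_inter_Iio_subset (hST : ∀ f ∈ S, f < e → f ∈ M.closure (T ∩ Set.Iio f) ∨ f ∈ T)
    (hS : S ⊆ M.E) : M.closure (S ∩ Set.Iio e) ⊆ M.closure (T ∩ Set.Iio e) := by
  refine M.closure_subset_closure_of_subset_closure ?_
  rintro f ⟨hfS, hfe⟩
  obtain hf | hfT := hST f hfS hfe
  · exact M.closure_subset_closure
      (Set.inter_subset_inter_right T (Set.Iio_subset_Iio (le_of_lt hfe))) hf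
  · exact M.mem_closure_of_mem' ⟨hfT, hfe⟩ (hS hfS)

theorem sdiff_greedyBasis_subset_externallyActiveSet [WellFoundedLT α] (hS : S ⊆ M.E) :
    S \ greedyBasis M S ⊆ externallyActiveSet M (greedyBasis M S) := by
  rintro e ⟨he, heB⟩
  refine ⟨heB, ?_⟩
  induction e using WellFoundedLT.induction with
  | ind e ih =>
    have hspan : e ∈ M.closure (S ∩ Set.Iio e) := by
      by_contra hspan
      exact heB ⟨he, hspan⟩
    exact closure_inter_Iio_subset
      (fun f hf hfe => or_iff_not_imp_right.2 fun hfB => ih f hfe hf hfB) hS hspan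

theorem indep_greedyBasis [M.Finitary] (hS : S ⊆ M.E) : M.Indep (greedyBasis M S) := by
  rw [← M.not_dep_iff (greedyBasis_subset.trans hS)]
  intro hdep
  obtain ⟨C, hCB, hC⟩ := hdep.exists_isCircuit_subset
  obtain ⟨e, he, hmax⟩ := Set.exists_max_image C id hC.finite hC.nonempty
  have hlt : C \ {e} ⊆ S ∩ Set.Iio e := fun f hf =>
    ⟨(hCB hf.1).1, lt_of_le_of_ne (hmax f hf.1) hf.2⟩
  exact (hCB he).2 (M.closure_subset_closure hlt (hC.mem_closure_sdiff_singleton_of_mem he))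

theorem subset_closure_of_mem_Icc (hS : S ∈ Set.Icc F (F ∪ externallyActiveSet M F))
    (hSE : S ⊆ M.E) : S ⊆ M.closure F :=
  hS.2.trans (Set.union_subset (M.subset_closure F (hS.1.trans hSE))
    externallyActiveSet_subset_closure)

/-- Crapo's interval partition. -/
theorem greedyBasis_eq_iff_mem_Icc [WellFoundedLT α] (hF : M.Indep F) (hS : S ⊆ M.E) :
    greedyBasis M S = F ↔ S ∈ Set.Icc F (F ∪ externallyActiveSet M F) := by
  constructor
  · rintro rfl
    exact ⟨greedyBasis_subset,
      Set.sdiff_subset_iff.1 (sdiff_greedyBasis_subset_externallyActiveSet hS)⟩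
  · rintro ⟨hFS, hSF⟩
    ext e
    constructor
    · rintro ⟨he, hspan⟩
      refine (hSF he).resolve_right fun hact => hspan ?_
      exact M.closure_subset_closure (Set.inter_subset_inter_left _ hFS) hact.2
    · refine fun he => ⟨hFS he, fun hspan => ?_⟩
      have hspanF : e ∈ M.closure (F ∩ Set.Iio e) :=
        closure_inter_Iio_subset (fun f hf _ => (hSF hf).symm.imp_left And.right) hS hspan
      refine hF.notMem_closure_sdiff_of_mem he (M.closure_subset_closure ?_ hspanF)
      exact fun f hf => ⟨hf.1, ne_of_lt hf.2⟩

end GreedyBasis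

theorem sum_Icc_pow_card_sub_card {α R : Type*} [DecidableEq α] [CommSemiring R] {s t : Finset α}
    (hst : s ⊆ t) (x : R) :
    ∑ r ∈ Finset.Icc s t, x ^ (r.card - s.card) = (x + 1) ^ (t \ s).card := by
  have hdisj : ∀ r ∈ (t \ s).powerset, Disjoint s r := fun r hr =>
    Finset.disjoint_sdiff.mono_right (Finset.mem_powerset.1 hr)
  have hinj : Set.InjOn (s ∪ ·) ((t \ s).powerset : Set (Finset α)) := fun r hr r' hr' h => by
    rw [← Finset.union_sdiff_cancel_left (hdisj r hr),
      ← Finset.union_sdiff_cancel_left (hdisj r' hr')]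
    exact congrArg (· \ s) h
  rw [Finset.Icc_eq_image_powerset hst, Finset.sum_image hinj, ← Finset.sum_pow_mul_eq_add_pow]
  refine Finset.sum_congr rfl fun r hr => ?_
  rw [Finset.card_union_of_disjoint (hdisj r hr), Nat.add_sub_cancel_left, one_pow, mul_one]

namespace Semimatroid

variable {E : Type*} {M₀ : Matroid (Option E)} {S F : Set E}

/-- The matroid on `E` obtained from `M₀` by deleting the basepoint `e₀ = none`. -/
def deletion (M₀ : Matroid (Option E)) : Matroid E := M₀.comap some

theorem mem_closure_deletion {e : E} :
    e ∈ (deletion M₀).closure S ↔ some e ∈ M₀.closure (some '' S) := by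
  rw [deletion, Matroid.comap_closure_eq, Set.mem_preimage]

theorem indep_deletion_iff : (deletion M₀).Indep F ↔ M₀.Indep (some '' F) := by
  rw [deletion, Matroid.comap_indep_iff, and_iff_left (Option.some_injective E).injOn]

theorem subset_deletion_ground (hM : M₀.E = Set.univ) (S : Set E) : S ⊆ (deletion M₀).E := by
  rw [deletion, Matroid.comap_ground_eq, hM, Set.preimage_univ]
  exact Set.subset_univ S

theorem SemiBalanced.of_subset_closure (hF : SemiBalanced M₀ F)
    (hSF : S ⊆ (deletion M₀).closure F) : SemiBalanced M₀ S := by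
  have hcl : some '' S ⊆ M₀.closure (some '' F) :=
    Set.image_subset_iff.2 fun _ he => mem_closure_deletion.1 (hSF he)
  exact fun h => hF (M₀.closure_subset_closure_of_subset_closure hcl h)

theorem SemiBalanced.mono (hS : SemiBalanced M₀ S) (hFS : F ⊆ S) : SemiBalanced M₀ F := fun h =>
  hS (M₀.closure_subset_closure (Set.image_mono hFS) h)

theorem SemiIndep.eRk_toNat_eq_card {F S : Finset E} (hF : SemiIndep M₀ F) (hFS : F ⊆ S)
    (hSF : (S : Set E) ⊆ (deletion M₀).closure F) :
    (M₀.eRk (some '' (S : Set E))).toNat = F.card := by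
  have hcl : some '' (S : Set E) ⊆ M₀.closure (some '' F) :=
    Set.image_subset_iff.2 fun _ he => mem_closure_deletion.1 (hSF he)
  have hrk : M₀.eRk (some '' (S : Set E)) = M₀.eRk (some '' (F : Set E)) :=
    ((M₀.eRk_mono hcl).trans_eq (M₀.eRk_closure_eq _)).antisymm
      (M₀.eRk_mono (Set.image_mono (Finset.coe_subset.2 hFS)))
  rw [hrk, hF.1.eRk_eq_encard, (Option.some_injective E).encard_image,
    Set.encard_coe_eq_coe_finsetCard, ENat.toNat_natCast]

theorem SemiIndep.setOf_externallyActive_eq (O : LinearOrder E) (hF : SemiIndep M₀ F) :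
    {e | ExternallyActive M₀ O F e} = externallyActiveSet (deletion M₀) F := by
  ext e
  have hsub : some '' (F ∩ Set.Iio e) ⊆ some '' F := Set.image_mono Set.inter_subset_left
  have hmax (heF : e ∉ F) (hcl : some e ∈ M₀.closure (some '' F)) :
      (∀ f, some f ∈ M₀.fundCircuit (some e) (some '' F) → O.le f e) ↔
        some e ∈ M₀.closure (some '' (F ∩ Set.Iio e)) := by
    rw [mem_closure_iff_fundCircuit_subset hF.1 hcl (by simpa using heF) hsub]
    constructor
    · intro hle x hx
      obtain rfl | ⟨f, hf, rfl⟩ := M₀.fundCircuit_subset_insert _ _ hx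
      · exact Set.mem_insert _ _
      · exact .inr ⟨f, ⟨hf, (hle f hx).lt_of_ne fun h => heF (h ▸ hf)⟩, rfl⟩
    · intro hC f hf
      obtain h | ⟨g, hg, h⟩ := hC hf
      · exact (Option.some_injective E h).le
      · exact (Option.some_injective E h) ▸ le_of_lt hg.2
  rw [externallyActiveSet, Set.mem_ofPred_eq, Set.mem_ofPred_eq, mem_closure_deletion]
  constructor
  · exact fun ⟨_, heF, hcl, hle⟩ => ⟨heF, (hmax heF hcl).1 hle⟩
  · intro ⟨heF, hlt⟩
    have hcl := M₀.closure_subset_closure hsub hlt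
    exact ⟨hF, heF, hcl, (hmax heF hcl).2 hlt⟩

theorem semiIndep_greedyBasis [Finite E] [LinearOrder E] (hM : M₀.E = Set.univ)
    (hS : SemiBalanced M₀ S) : SemiIndep M₀ (greedyBasis (deletion M₀) S) :=
  ⟨indep_deletion_iff.1 (indep_greedyBasis (subset_deletion_ground hM S)),
    hS.mono greedyBasis_subset⟩

theorem SemiIndep.greedyBasis_eq_iff_mem_Icc [Finite E] [LinearOrder E] (hM : M₀.E = Set.univ)
    (hF : SemiIndep M₀ F) :
    SemiBalanced M₀ S ∧ greedyBasis (deletion M₀) S = F ↔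
      S ∈ Set.Icc F (F ∪ externallyActiveSet (deletion M₀) F) := by
  have hS := subset_deletion_ground hM S
  rw [_root_.greedyBasis_eq_iff_mem_Icc (indep_deletion_iff.2 hF.1) hS, and_iff_right_iff_imp]
  exact fun h => hF.2.of_subset_closure (subset_closure_of_mem_Icc h hS)

variable {R : Type*} [CommSemiring R]

open Classical in
theorem SemiIndep.sum_filter_greedyBasis_eq [Fintype E] [O : LinearOrder E] (hM : M₀.E = Set.univ)
    {F : Finset E} (hF : SemiIndep M₀ F) (x : R) :
    ∑ S ∈ Finset.univ.filter fun S : Finset E =>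
        SemiBalanced M₀ S ∧ greedyBasis (deletion M₀) (S : Set E) = F,
      x ^ (S.card - F.card) = (x + 1) ^ numExtActive M₀ O F := by
  set A : Finset E := (externallyActiveSet (deletion M₀) (F : Set E)).toFinset with hA
  have hdisj : Disjoint F A := Finset.disjoint_right.2 fun e he => (Set.mem_toFinset.1 he).1
  have hfiber : (Finset.univ.filter fun S : Finset E =>
      SemiBalanced M₀ S ∧ greedyBasis (deletion M₀) (S : Set E) = F) = Finset.Icc F (F ∪ A) := by
    ext S
    rw [Finset.mem_filter, and_iff_right (Finset.mem_univ S), hF.greedyBasis_eq_iff_mem_Icc hM,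
      Finset.mem_Icc, Set.mem_Icc, ← Set.coe_toFinset (externallyActiveSet _ _),
      ← Finset.coe_union, Finset.coe_subset, Finset.coe_subset]
  rw [hfiber, sum_Icc_pow_card_sub_card Finset.subset_union_left,
    Finset.union_sdiff_cancel_left hdisj, numExtActive, hF.setOf_externallyActive_eq, hA,
    Set.ncard_eq_toFinset_card']

open Classical in
theorem sum_semiBalanced_eq_sum_semiIndep [Fintype E] (hM : M₀.E = Set.univ) (O : LinearOrder E)
    (x : R) (w : Set E → R)
    (hw : ∀ ⦃F S : Set E⦄, SemiIndep M₀ F → F ⊆ S → S ⊆ (deletion M₀).closure F → w S = w F) :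
    ∑ S ∈ Finset.univ.filter fun S : Finset E => SemiBalanced M₀ S,
        x ^ (S.card - (M₀.eRk (some '' (S : Set E))).toNat) * w S =
      ∑ F ∈ Finset.univ.filter fun F : Finset E => SemiIndep M₀ F,
        (x + 1) ^ numExtActive M₀ O F * w F := by
  have hmaps : ∀ S ∈ Finset.univ.filter fun S : Finset E => SemiBalanced M₀ S,
      (greedyBasis (deletion M₀) (S : Set E)).toFinset ∈
        Finset.univ.filter fun F : Finset E => SemiIndep M₀ F := by
    intro S hS
    rw [Finset.mem_filter, Set.coe_toFinset]
    exact ⟨Finset.mem_univ _, semiIndep_greedyBasis hM (Finset.mem_filter.1 hS).2⟩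
  rw [← Finset.sum_fiberwise_of_maps_to hmaps]
  refine Finset.sum_congr rfl fun F hF => ?_
  replace hF : SemiIndep M₀ F := (Finset.mem_filter.1 hF).2
  rw [← hF.sum_filter_greedyBasis_eq hM, Finset.sum_mul, Finset.filter_filter]
  refine Finset.sum_congr (Finset.filter_congr fun S _ => ?_) fun S hS => ?_
  · rw [← Finset.coe_inj, Set.coe_toFinset]
  · have hIcc := (hF.greedyBasis_eq_iff_mem_Icc hM).1 (Finset.mem_filter.1 hS).2
    have hcl := subset_closure_of_mem_Icc hIcc (subset_deletion_ground hM _)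
    rw [hF.eRk_toNat_eq_card (Finset.coe_subset.1 hIcc.1) hcl, hw hF hIcc.1 hcl]

end Semimatroid

namespace GainGraph

section Forest

variable {V E G : Type*} [Group G] {Φ : GainGraph V E G}

theorem IsForest.mono {F F' : Set E} (hF : Φ.IsForest F) (h : F' ⊆ F) : Φ.IsForest F' :=
  ⟨fun e he => hF.1 e (h he), fun v p hp hF' => hF.2 v p hp fun e he => h (hF' e he)⟩

theorem IsForest.balanced {F : Set E} (hF : Φ.IsForest F) : Φ.Balanced F :=
  ⟨fun e he => (hF.1 e he).1, fun v p hp h => absurd h (hF.2 v p hp)⟩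

theorem exists_step_iff {e : E} :
    (∃ v w g, Φ.Step e v w g) ↔ ¬ Φ.IsHalf e ∧ ¬ Φ.IsLoose e := by
  constructor
  · rintro ⟨v, w, g, h | h⟩ <;> simp [IsHalf, IsLoose, h]
  · rintro ⟨hhalf, hloose⟩
    cases he : Φ.edge e with
    | arc v w g => exact ⟨v, w, g, .fwd he⟩
    | half v => exact absurd ⟨v, he⟩ hhalf
    | loose => exact absurd he hloose

theorem Step.conn_iff {S : Set E} {e : E} {v w x y : V} {g k : G} (h : Φ.Step e v w g)
    (h' : Φ.Step e x y k) : Φ.Conn S v w ↔ Φ.Conn S x y := by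
  obtain ⟨rfl, rfl, -⟩ | ⟨rfl, rfl, -⟩ := h.eq_or h'
  · rfl
  · exact ⟨Conn.symm, Conn.symm⟩

theorem Walk.IsCircle.exists_step_conn {F : Set E} {v : V} {p : Φ.Walk v v} (hp : p.IsCircle)
    (hpF : ∀ e ∈ p.edges, e ∈ F) : ∃ e ∈ F, ∃ w g, Φ.Step e v w g ∧ Φ.Conn (F \ {e}) v w := by
  cases p with
  | nil => exact absurd rfl hp.1
  | @cons _ w _ e g hst p =>
    have hnd := hp.2.1
    simp only [Walk.edges, List.nodup_cons] at hnd
    simp only [Walk.edges, List.mem_cons, forall_eq_or_imp] at hpF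
    exact ⟨e, hpF.1, w, g, hst,
      Conn.symm ⟨p, fun f hf => ⟨hpF.2 f hf, fun h => hnd.1 (h ▸ hf)⟩⟩⟩

theorem IsForest.not_conn {F : Set E} {e : E} (hF : Φ.IsForest F) (he : e ∈ F)
    {v w : V} {g : G} (hst : Φ.Step e v w g) : ¬ Φ.Conn (F \ {e}) v w := by
  intro hvw
  obtain ⟨p, hp⟩ := hvw.symm
  obtain ⟨q, hq, hqF, -⟩ := (hF.mono Set.sdiff_subset).balanced.exists_path p hp
  have heq : e ∉ q.edges := fun h => (hqF e h).2 rfl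
  refine hF.2 v (.cons e g hst q) ⟨by simp [Walk.edges], ?_, by simpa [Walk.support] using hq⟩ ?_
  · simpa only [Walk.edges, List.nodup_cons] using ⟨heq, q.edges_nodup hq⟩
  · simpa only [Walk.edges, List.mem_cons, forall_eq_or_imp] using ⟨he, fun f hf => (hqF f hf).1⟩

theorem isForest_iff_forall_exists_not_conn {F : Set E} :
    Φ.IsForest F ↔ ∀ e ∈ F, ∃ v w g, Φ.Step e v w g ∧ ¬ Φ.Conn (F \ {e}) v w := by
  constructor
  · intro hF e he
    obtain ⟨v, w, g, hst⟩ := exists_step_iff.2 (hF.1 e he)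
    exact ⟨v, w, g, hst, hF.not_conn he hst⟩
  · intro hF
    refine ⟨fun e he => ?_, fun v p hp hpF => ?_⟩
    · obtain ⟨v, w, g, hst, -⟩ := hF e he
      exact exists_step_iff.1 ⟨v, w, g, hst⟩
    · obtain ⟨e, he, w, g, hst, hvw⟩ := hp.exists_step_conn hpF
      obtain ⟨x, y, k, hst', hxy⟩ := hF e he
      exact hxy ((hst.conn_iff hst').1 hvw)

end Forest

section LiftMatroid

open Semimatroid

variable {V E G : Type*} [Group G] [Fintype V] {Φ : GainGraph V E G} {S F : Set E}

theorem liftRank_image_some (hS : Φ.Balanced S) :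
    Φ.liftRank (some '' S) = Fintype.card V - Φ.numComp S := by
  simp [liftRank, Set.preimage_image_eq _ (Option.some_injective E), hS]

variable [Finite E]

theorem Balanced.eRk_toNat (hS : Φ.Balanced S) :
    (Φ.liftMatroid.eRk (some '' S)).toNat = Fintype.card V - Φ.numComp S := by
  rw [liftMatroid_eRk, ENat.toNat_natCast, liftRank_image_some hS]

theorem mem_closure_liftMatroid {X : Set (Option E)} {x : Option E} :
    x ∈ Φ.liftMatroid.closure X ↔ Φ.liftRank (insert x X) = Φ.liftRank X := by
  constructor
  · intro hx
    have h := Φ.liftMatroid.eRk_insert_closure_eq x X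
    rw [Set.insert_eq_of_mem hx, Matroid.eRk_closure_eq, liftMatroid_eRk, liftMatroid_eRk] at h
    exact_mod_cast h.symm
  · intro h
    by_contra hx
    have hrk := Matroid.eRk_insert_eq_add_one (M := Φ.liftMatroid) ⟨Set.mem_univ x, hx⟩
    rw [liftMatroid_eRk, liftMatroid_eRk, h] at hrk
    norm_cast at hrk
    omega

theorem semiBalanced_liftMatroid_iff : SemiBalanced Φ.liftMatroid S ↔ Φ.Balanced S := by
  rw [SemiBalanced, mem_closure_liftMatroid]
  have h : (some ⁻¹' (insert none (some '' S)) : Set E) = S := by ext; simp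
  simp [liftRank, h, Set.preimage_image_eq _ (Option.some_injective E)]

theorem mem_closure_deletion_liftMatroid {e : E} (hS : Φ.Balanced (insert e S)) :
    e ∈ (deletion Φ.liftMatroid).closure S ↔ ∀ v w g, Φ.Step e v w g → Φ.Conn S v w := by
  rw [mem_closure_deletion, mem_closure_liftMatroid, ← Set.image_insert_eq,
    liftRank_image_some hS, liftRank_image_some (hS.mono (Set.subset_insert e S))]
  constructor
  · intro hrk v w g hst
    by_contra hvw
    have hcomp := numComp_insert_of_not_conn hst hvw
    have hle := Φ.numComp_le S
    omega
  · intro hconn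
    rw [numComp_insert_of_conn hconn]

theorem Balanced.of_subset_closure (hF : Φ.Balanced F)
    (hSF : S ⊆ (deletion Φ.liftMatroid).closure F) : Φ.Balanced S :=
  semiBalanced_liftMatroid_iff.1 ((semiBalanced_liftMatroid_iff.2 hF).of_subset_closure hSF)

theorem Balanced.parts_eq_of_subset_closure (hF : Φ.Balanced F) (hFS : F ⊆ S)
    (hSF : S ⊆ (deletion Φ.liftMatroid).closure F) : Φ.parts S = Φ.parts F := by
  rw [← Set.union_eq_self_of_subset_left hFS]
  refine parts_union fun e he => (mem_closure_deletion_liftMatroid ?_).1 (hSF he)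
  exact hF.of_subset_closure (Set.insert_subset (hSF he) (hFS.trans hSF))

theorem Balanced.indep_deletion_liftMatroid_iff (hF : Φ.Balanced F) :
    (deletion Φ.liftMatroid).Indep F ↔ Φ.IsForest F := by
  rw [Matroid.indep_iff_forall_notMem_closure_sdiff
      (subset_deletion_ground liftMatroid_ground F),
    isForest_iff_forall_exists_not_conn]
  refine forall₂_congr fun e he => ?_
  have hins : insert e (F \ {e}) = F := by
    rw [Set.insert_sdiff_singleton, Set.insert_eq_of_mem he]
  rw [mem_closure_deletion_liftMatroid (hins.symm ▸ hF)]
  simp only [not_forall, exists_prop]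

theorem semiIndep_liftMatroid_iff : SemiIndep Φ.liftMatroid F ↔ Φ.IsForest F := by
  rw [SemiIndep, semiBalanced_liftMatroid_iff, ← indep_deletion_iff]
  exact ⟨fun ⟨hind, hF⟩ => hF.indep_deletion_liftMatroid_iff.1 hind,
    fun hF => ⟨hF.balanced.indep_deletion_liftMatroid_iff.2 hF, hF.balanced⟩⟩

end LiftMatroid

section BalancedParts

variable {V E G : Type*} [Group G] [Fintype V] {Φ : GainGraph V E G} {S : Set E}

theorem Balanced.balParts_eq_parts (hS : Φ.Balanced S) : Φ.balParts S = Φ.parts S := by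
  ext W
  rw [mem_balParts]
  exact and_iff_left (hS.mono fun _ h => h.1)

theorem balParts_subset_parts : Φ.balParts S ⊆ Φ.parts S := fun _ hW => (mem_balParts.1 hW).1

theorem balanced_iff_forall_induce_comp :
    Φ.Balanced S ↔ ∀ v, Φ.Balanced (Φ.induce S (Φ.comp S v : Set V)) := by
  constructor
  · exact fun hS v => hS.mono fun _ h => h.1
  · intro hS
    refine balanced_iff.2 ⟨fun e he ⟨v, hv⟩ => (hS v).1 e ?_ ⟨v, hv⟩, ?_⟩
    · simp [induce, ends, hv, he, mem_comp_self]
    · -- Switching functions of the components are glued along the choice of a component.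
      choose! η hη using fun (W : Finset V) (hW : Φ.Balanced (Φ.induce S (W : Set V))) =>
        hW.exists_switching
      refine ⟨fun x => η (Φ.comp S x) x, fun e he v w g hst => ?_⟩
      have hvw : Φ.Conn S v w := Conn.step he (.fwd hst)
      simp only [← comp_eq_iff.2 hvw]
      refine hη _ (hS v) e ?_ v w g hst
      exact mem_induce_of_step he (.fwd hst) (mem_comp_self S v) (mem_comp.2 hvw)

theorem numBal_le_numComp : Φ.numBal S ≤ Φ.numComp S := Finset.card_le_card balParts_subset_parts

theorem numBal_eq_numComp_iff : Φ.numBal S = Φ.numComp S ↔ Φ.Balanced S := by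
  constructor
  · intro h
    have hparts := Finset.eq_of_subset_of_card_le balParts_subset_parts h.ge
    refine balanced_iff_forall_induce_comp.2 fun v => (mem_balParts.1 ?_).2
    exact hparts ▸ mem_parts.2 ⟨v, rfl⟩
  · intro hS
    rw [numBal, hS.balParts_eq_parts, numComp]

end BalancedParts

section ContractWeight

variable {V E G : Type*} [Group G] [Lattice G] [Fintype V] {Φ : GainGraph V E G} {S F : Set E}

theorem IsTopSwitching.mono {η : V → G} (hη : Φ.IsTopSwitching S η) (hFS : F ⊆ S)
    (h : Φ.balParts F ⊆ Φ.balParts S) : Φ.IsTopSwitching F η := fun W hW =>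
  ⟨fun e he => (hη W (h hW)).1 e ⟨hFS he.1, he.2⟩, (hη W (h hW)).2⟩

variable [MulLeftMono G] [MulRightMono G] {K : Type*} [AddCommSemigroup K] [MulAction Gᵐᵒᵖ K]

theorem contractWeight_eq_of_subset (h : V → K) (hFS : F ⊆ S)
    (hp : Φ.balParts F ⊆ Φ.balParts S) {W : Finset V} (hW : W ∈ Φ.balParts F) (hne : W.Nonempty) :
    Φ.contractWeight h S W hne = Φ.contractWeight h F W hne := by
  have hη := (Φ.topSwitching_spec S).mono hFS hp
  rw [← WithZero.coe_inj, contractWeight, contractWeight, Finset.coe_nonemptySum,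
    Finset.coe_nonemptySum]
  refine Finset.sum_congr rfl fun v hv => ?_
  rw [hη.unique (Φ.topSwitching_spec F) hW hv]

variable {R : Type*} [CommMonoid R]

/-- The weight `∏_{W ∈ π_b(S)} u_{h/S(W)}` of an edge set `S` in the total dichromatic polynomial;
for a spanning forest it is also the weight in the forest expansion. -/
noncomputable def weightProd (Φ : GainGraph V E G) (h : V → K) (u : K → R) (S : Set E) : R :=
  ∏ W : {W // W ∈ Φ.balParts S}, u (Φ.contractWeight h S W.1 (balParts_nonempty W.2))

variable (h : V → K) (u : K → R)

theorem weightProd_eq_of_subset (hFS : F ⊆ S) (hp : Φ.balParts S = Φ.balParts F) :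
    Φ.weightProd h u S = Φ.weightProd h u F := by
  refine Fintype.prod_equiv (Equiv.subtypeEquivRight fun W => by rw [hp]) _ _ fun W => ?_
  exact congrArg u (contractWeight_eq_of_subset h hFS hp.ge (hp ▸ W.2) _)

theorem Balanced.weightProd_eq_of_subset_closure [Finite E] (hF : Φ.Balanced F) (hFS : F ⊆ S)
    (hSF : S ⊆ (Semimatroid.deletion Φ.liftMatroid).closure F) :
    Φ.weightProd h u S = Φ.weightProd h u F := by
  refine weightProd_eq_of_subset h u hFS ?_
  rw [(hF.of_subset_closure hSF).balParts_eq_parts, hF.balParts_eq_parts,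
    hF.parts_eq_of_subset_closure hFS hSF]

theorem Balanced.prod_parts_eq_weightProd (hF : Φ.Balanced F) :
    ∏ W : {W // W ∈ Φ.parts F}, u (Φ.contractWeight h F W.1 (parts_nonempty W.2)) =
      Φ.weightProd h u F :=
  Fintype.prod_equiv (Equiv.subtypeEquivRight fun W => by rw [hF.balParts_eq_parts]) _ _
    fun _ => rfl

end ContractWeight

section Expansions

variable {V E G K R : Type*} [Fintype V] [Fintype E] [Group G] [Lattice G] [MulLeftMono G]
  [MulRightMono G] [AddCommSemigroup K] [MulAction Gᵐᵒᵖ K] [CommRing R] {Φ : GainGraph V E G}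
  (h : V → K) (u : K → R)

open Classical in
theorem totalDichromatic_zero (v : R) :
    Φ.totalDichromatic h u v 0 = ∑ S ∈ Finset.univ.filter fun S : Finset E => Φ.Balanced S,
      v ^ (S.card + Φ.numComp (S : Set E) - Fintype.card V) * Φ.weightProd h u S := by
  rw [totalDichromatic, Finset.sum_filter]
  refine Finset.sum_congr rfl fun S _ => ?_
  split_ifs with hS
  · rw [numBal_eq_numComp_iff.2 hS, Nat.sub_self, pow_zero, mul_one, weightProd]
  · have hlt := numBal_le_numComp.lt_of_ne (mt numBal_eq_numComp_iff.1 hS)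
    rw [zero_pow (Nat.sub_pos_of_lt hlt).ne', mul_zero, zero_mul]

open Classical in
theorem forestExpansion_eq_sum (O : LinearOrder E) (y : R) :
    Φ.forestExpansion h O u y = ∑ F ∈ Finset.univ.filter fun F : Finset E => Φ.IsForest F,
      y ^ Semimatroid.numExtActive Φ.liftMatroid O F * Φ.weightProd h u F := by
  -- The sum in `forestExpansion` elaborates to one over `Set E`, along the image of `Finset.univ`.
  symm
  refine Finset.sum_bij (fun F _ => (F : Set E)) (fun F hF => ?_)
    (fun F _ F' _ hFF' => Finset.coe_injective hFF') (fun F hF => ?_) fun F hF => ?_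
  · simpa using hF
  · exact ⟨F.toFinset, by simpa using (Finset.mem_filter.1 hF).2, Set.coe_toFinset F⟩
  · rw [(Finset.mem_filter.1 hF).2.balanced.prod_parts_eq_weightProd h u]

end Expansions

end GainGraph

theorem theoremT_general {V E G K R : Type*} [Fintype V] [Fintype E]
    [Group G] [Lattice G] [MulLeftMono G] [MulRightMono G]
    [AddCommSemigroup K] [MulAction Gᵐᵒᵖ K] [CommRing R]
    (Φ : GainGraph V E G) (h : V → K) (u : K → R) (y : R) (O : LinearOrder E) :
    Φ.forestExpansion h O u y = Φ.totalDichromatic h u (y - 1) 0 := by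
  classical
  have hweight : ∀ ⦃F S : Set E⦄, Semimatroid.SemiIndep Φ.liftMatroid F → F ⊆ S →
      S ⊆ (Semimatroid.deletion Φ.liftMatroid).closure F →
      Φ.weightProd h u S = Φ.weightProd h u F := fun F S hF =>
    (GainGraph.semiIndep_liftMatroid_iff.1 hF).balanced.weightProd_eq_of_subset_closure h u
  have hsum := Semimatroid.sum_semiBalanced_eq_sum_semiIndep GainGraph.liftMatroid_ground O
    (y - 1) (Φ.weightProd h u) hweight
  simp only [sub_add_cancel, GainGraph.semiBalanced_liftMatroid_iff,
    GainGraph.semiIndep_liftMatroid_iff] at hsum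
  rw [GainGraph.forestExpansion_eq_sum, GainGraph.totalDichromatic_zero, ← hsum]
  refine Finset.sum_congr rfl fun S hS => ?_
  have hcard := Φ.numComp_le (S : Set E)
  rw [(Finset.mem_filter.1 hS).2.eRk_toNat, tsub_tsub_eq_add_tsub_of_le hcard]

theorem theoremT {V E G K R : Type*} [Fintype V] [Fintype E]
    [Group G] [Lattice G] [MulLeftMono G] [MulRightMono G]
    [AddCommSemigroup K] [MulAction Gᵐᵒᵖ K]
    (hact : ∀ (g : Gᵐᵒᵖ) (a b : K), g • (a + b) = g • a + g • b)
    [CommRing R] (Φ : GainGraph V E G) (h : V → K) (u : K → R) (y : R) :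
    (∀ O O' : LinearOrder E, Φ.forestExpansion h O u y = Φ.forestExpansion h O' u y) ∧
      ∀ O : LinearOrder E, Φ.forestExpansion h O u y = Φ.totalDichromatic h u (y - 1) 0 :=
  ⟨fun O O' => (theoremT_general Φ h u y O).trans (theoremT_general Φ h u y O').symm,
    theoremT_general Φ h u y⟩
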